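/- For a measurable set $E\subset\mathbb R$ or $E\subset\mathbb R^2$ let $|E|$ denote its Lebesgue measure. Let $\mathcal F_{\mathrm{mon}}$ be the set of measurable functions $f\colon[0,1]\to[0,1]$ such that 1. $\int_E f(x)\,dx\ge \frac{|E|^2}{2}$ for every measurable $E\subset[0,1]$, and $\int_0^1 f(x)\,dx=\frac12$; 2. there exists $\kappa\in[0,1]$ such that $\int_0^\kappa f(x)\,dx=\int_\kappa^1 f(x)\,dx=\frac14$, the restriction $f|_{[0,\kappa]}$ is non-decreasing, and $f|_{[\kappa,1]}$ is non-increasing. For $f\in\mathcal F_{\mathrm{mon}}$ put $$L(f)=\Big\{(x,y)\in[0,1]^2 : x\le y,\ \int_x^y f(t)\,dt\ge \tfrac14\Big\}.$$ Then $|L(f)|\le\frac{\pi}{16}$ for every $f\in\mathcal F_{\mathrm{mon}}$. Moreover, the tent map $x\mapsto 2\min(x,1-x)$ on $[0,1]$ belongs to $\mathcal F_{\mathrm{mon}}$ and attains equality, and it is the only element of $\mathcal F_{\mathrm{mon}}$ that does. -/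

import Mathlib

open MeasureTheory Set

/-- The class `F`: (Lebesgue) measurable functions `f : [0,1] → [0,1]` such that
`∫_E f ≥ |E|² / 2` for every measurable `E ⊆ [0,1]`, and `∫_0^1 f = 1/2`.
A function on `[0,1]` is represented by a function `ℝ → ℝ` of which only the values
on `[0,1]` matter. -/
structure IsF (f : ℝ → ℝ) : Prop where
  aemeasurable : AEMeasurable f (volume.restrict (Icc (0 : ℝ) 1))
  mapsTo : MapsTo f (Icc (0 : ℝ) 1) (Icc (0 : ℝ) 1)
  le_setIntegral : ∀ E : Set ℝ, MeasurableSet E → E ⊆ Icc (0 : ℝ) 1 →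
    (volume E).toReal ^ 2 / 2 ≤ ∫ x in E, f x
  integral_eq : ∫ x in (0 : ℝ)..1, f x = 1 / 2

/-- The class `F_mon`: functions in `F` for which there is a point `κ ∈ [0,1]` splitting the
integral in half, such that `f` is (weakly) increasing on `[0,κ]` and (weakly) decreasing
on `[κ,1]`. -/
structure IsFMon (f : ℝ → ℝ) : Prop extends IsF f where
  exists_mode : ∃ κ ∈ Icc (0 : ℝ) 1,
    (∫ x in (0 : ℝ)..κ, f x = 1 / 4) ∧ (∫ x in κ..(1 : ℝ), f x = 1 / 4) ∧
    MonotoneOn f (Icc 0 κ) ∧ AntitoneOn f (Icc κ 1)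

/-- `L(f) = {(x,y) ∈ [0,1]² : x ≤ y, ∫_x^y f ≥ 1/4}`. -/
def largeSet (f : ℝ → ℝ) : Set (ℝ × ℝ) :=
  {p | p.1 ∈ Icc (0 : ℝ) 1 ∧ p.2 ∈ Icc (0 : ℝ) 1 ∧ p.1 ≤ p.2 ∧
    1 / 4 ≤ ∫ t in p.1..p.2, f t}

/-- The tent map `x ↦ 2 min(x, 1 - x)`. -/
noncomputable def tentMap (x : ℝ) : ℝ := 2 * min x (1 - x)

/-! Let `Φ` be the primitive of `f`, and put `F x = Φ x` and `G y = 1/2 - Φ (1 - y)`. Reflecting the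
second coordinate turns `L(f)` into the region `K = {F x + G y ≤ 1/4}`, which lies under a
decreasing graph `k`. Testing the measure condition on `[0,x] ∪ [1-y,1]` gives `(x + y)² / 2 ≤ F x +
G y`. Let `l` be the graph bounding the reflection `K'` of `K` in the diagonal. Adding this
inequality at `(x, y)` and at `(l y, k x)` gives `(x + y)² + (k x + l y)² ≤ 1`, so the Minkowski sum
`K + K'` lies in a quarter of the unit disc. Since `K` and `K'` have the same area, Brunn-Minkowski
yields `4|K| ≤ π/4`. This is proved by transport in `integral_le_and_eq_of_add_sq_le`.

Equality forces `K = K'` to be a quarter disc of radius 1/2. The test inequality then forces `F x =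
G x = x²`, and monotonicity upgrades this to `f = tentMap` at every point. -/

/-! ### Inverses of increasing functions and of primitives -/

/-- A continuous strictly increasing function on `[a, b]` has an inverse that extends to a
continuous function on the whole line. -/
theorem exists_continuous_inverse {φ : ℝ → ℝ} {a b : ℝ} (hab : a ≤ b)
    (hc : ContinuousOn φ (Icc a b)) (hm : StrictMonoOn φ (Icc a b)) :
    ∃ g : ℝ → ℝ, Continuous g ∧ (∀ m, g m ∈ Icc a b) ∧
      (∀ m ∈ Icc (φ a) (φ b), φ (g m) = m) ∧ (∀ x ∈ Icc a b, g (φ x) = x) := by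
  have hle : φ a ≤ φ b := hm.monotoneOn ⟨le_rfl, hab⟩ ⟨hab, le_rfl⟩ hab
  have hmaps : ∀ x ∈ Icc a b, φ x ∈ Icc (φ a) (φ b) := fun x hx =>
    ⟨hm.monotoneOn ⟨le_rfl, hab⟩ hx hx.1, hm.monotoneOn hx ⟨hab, le_rfl⟩ hx.2⟩
  let ψ : Icc a b → Icc (φ a) (φ b) := fun x => ⟨φ x, hmaps x x.2⟩
  have hψ : StrictMono ψ := fun x y hxy => hm x.2 y.2 hxy
  have hsurj : Function.Surjective ψ := by
    rintro ⟨y, hy⟩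
    obtain ⟨x, hx, rfl⟩ := intermediate_value_Icc hab hc hy
    exact ⟨⟨x, hx⟩, rfl⟩
  let e := hψ.orderIsoOfSurjective ψ hsurj
  refine ⟨fun m => e.symm (projIcc _ _ hle m), ?_, fun m => (e.symm _).2, ?_, ?_⟩
  · exact continuous_subtype_val.comp (e.symm.continuous.comp continuous_projIcc)
  · intro m hm'
    have h : e (e.symm (projIcc _ _ hle m)) = projIcc _ _ hle m := e.apply_symm_apply _
    have h2 := congrArg Subtype.val h
    exact h2.trans (congrArg Subtype.val (projIcc_of_mem hle hm'))
  · intro x hx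
    have h : e.symm (e ⟨x, hx⟩) = ⟨x, hx⟩ := e.symm_apply_apply _
    have h2 : projIcc _ _ hle (φ x) = e ⟨x, hx⟩ := projIcc_of_mem hle (hmaps x hx)
    simp only [h2, h]

/-- The inverse function of the primitive of a function positive on `[0, b)`. -/
theorem exists_inverse_primitive {k : ℝ → ℝ} {b : ℝ} (hb : 0 < b) (hk : Continuous k)
    (hpos : ∀ x ∈ Ico 0 b, 0 < k x) :
    ∃ g : ℝ → ℝ, Continuous g ∧ g 0 = 0 ∧ g (∫ t in (0 : ℝ)..b, k t) = b ∧
      (∀ m ∈ Ioo 0 (∫ t in (0 : ℝ)..b, k t), g m ∈ Ioo 0 b ∧ HasDerivAt g (k (g m))⁻¹ m) ∧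
      ∀ x ∈ Ioo 0 b, ∃ m ∈ Ioo 0 (∫ t in (0 : ℝ)..b, k t), g m = x := by
  set Φ : ℝ → ℝ := fun x => ∫ t in (0 : ℝ)..x, k t with hΦ
  have hd : ∀ x, HasDerivAt Φ (k x) x := fun x =>
    intervalIntegral.integral_hasDerivAt_right (hk.intervalIntegrable _ _)
      (hk.stronglyMeasurableAtFilter _ _) hk.continuousAt
  have hcont : Continuous Φ := continuous_iff_continuousAt.2 fun x => (hd x).continuousAt
  have hmono : StrictMonoOn Φ (Icc 0 b) := by
    refine strictMonoOn_of_deriv_pos (convex_Icc 0 b) hcont.continuousOn fun x hx => ?_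
    rw [interior_Icc] at hx
    rw [(hd x).deriv]
    exact hpos x ⟨hx.1.le, hx.2⟩
  have h0 : Φ 0 = 0 := by simp [hΦ]
  obtain ⟨g, gc, gm, g1, g2⟩ := exists_continuous_inverse hb.le hcont.continuousOn hmono
  have e0 : g 0 = 0 := by simpa [h0] using g2 0 ⟨le_rfl, hb.le⟩
  have eb : g (Φ b) = b := g2 b ⟨hb.le, le_rfl⟩
  rw [h0] at g1
  refine ⟨g, gc, e0, eb, fun m hm => ?_, fun x hx => ⟨Φ x, ⟨?_, ?_⟩, g2 x ⟨hx.1.le, hx.2.le⟩⟩⟩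
  · have hgm : g m ∈ Ioo 0 b := by
      have h := g1 m ⟨hm.1.le, hm.2.le⟩
      refine ⟨lt_of_le_of_ne (gm m).1 fun h' => ?_, lt_of_le_of_ne (gm m).2 fun h' => ?_⟩
      · rw [← h', h0] at h
        exact hm.1.ne h
      · rw [h'] at h
        exact hm.2.ne h.symm
    refine ⟨hgm, HasDerivAt.of_local_left_inverse gc.continuousAt (hd _)
      (hpos _ ⟨hgm.1.le, hgm.2⟩).ne' ?_⟩
    filter_upwards [Icc_mem_nhds hm.1 hm.2] with y hy using g1 y hy
  · rw [← h0]
    exact hmono ⟨le_rfl, hb.le⟩ ⟨hx.1.le, hx.2.le⟩ hx.1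
  · exact hmono ⟨hx.1.le, hx.2.le⟩ ⟨hb.le, le_rfl⟩ hx.2

/-! ### Brunn-Minkowski by one-dimensional transport -/

theorem integral_sqrt_one_sub_sq_zero_one : ∫ t in (0 : ℝ)..1, √(1 - t ^ 2) = Real.pi / 4 := by
  have hi : ∀ a b : ℝ, IntervalIntegrable (fun t : ℝ => √(1 - t ^ 2)) volume a b := fun a b =>
    (by fun_prop : Continuous fun t : ℝ => √(1 - t ^ 2)).intervalIntegrable a b
  have h1 := intervalIntegral.integral_add_adjacent_intervals (hi (-1) 0) (hi 0 1)
  have h2 := intervalIntegral.integral_comp_neg (a := 0) (b := 1) fun t : ℝ => √(1 - t ^ 2)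
  simp only [even_two.neg_pow, neg_zero] at h2
  have h3 := integral_sqrt_one_sub_sq
  linarith

/-- The area bound behind the planar Brunn-Minkowski inequality for a region under a decreasing
graph and its reflection, when their Minkowski average lies in the disc of radius `1/2`. -/
theorem integral_le_and_eq_of_add_sq_le {k l : ℝ → ℝ} {b c : ℝ} (hb : 0 < b) (hc : 0 < c)
    (hbc : b + c = 1) (hk : Continuous k) (hl : Continuous l)
    (hkpos : ∀ x ∈ Ico 0 b, 0 < k x) (hlpos : ∀ y ∈ Ico 0 c, 0 < l y)
    (hint : ∫ t in (0 : ℝ)..b, k t = ∫ t in (0 : ℝ)..c, l t)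
    (h : ∀ x ∈ Icc 0 b, ∀ y ∈ Icc 0 c, (x + y) ^ 2 + (k x + l y) ^ 2 ≤ 1) :
    ∫ t in (0 : ℝ)..b, k t ≤ Real.pi / 16 ∧
      (∫ t in (0 : ℝ)..b, k t = Real.pi / 16 →
        b = 1 / 2 ∧ ∀ x ∈ Ioo 0 b, l x = k x ∧ x ^ 2 + k x ^ 2 = 1 / 4) := by
  obtain ⟨g, gc, g0, gA, gd, gs⟩ := exists_inverse_primitive hb hk hkpos
  obtain ⟨u, uc, u0, uA, ud, -⟩ := exists_inverse_primitive hc hl hlpos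
  rw [← hint] at uA ud
  set A := ∫ t in (0 : ℝ)..b, k t with hA
  have hApos : 0 < A := intervalIntegral.intervalIntegral_pos_of_pos_on
    (hk.intervalIntegrable _ _) (fun x hx => hkpos x ⟨hx.1.le, hx.2⟩) hb
  set S : ℝ → ℝ := fun x => ∫ t in (0 : ℝ)..x, √(1 - t ^ 2) with hS
  have hsc : Continuous fun t : ℝ => √(1 - t ^ 2) := by fun_prop
  have hSd : ∀ x, HasDerivAt S (√(1 - x ^ 2)) x := fun x =>
    intervalIntegral.integral_hasDerivAt_right (hsc.intervalIntegrable _ _)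
      (hsc.stronglyMeasurableAtFilter _ _) hsc.continuousAt
  have hScont : Continuous S := continuous_iff_continuousAt.2 fun x => (hSd x).continuousAt
  -- `g m` and `u m` are the abscissas up to which the areas under `k` and `l` equal `m`. `W`
  -- compares the area under the unit circle up to `g m + u m` with `4 * m`; at `m = A` this is the
  -- claim.
  set W : ℝ → ℝ := fun m => S (g m + u m) - 4 * m with hW
  have hWc : Continuous W := by fun_prop
  have hWd : ∀ m ∈ Ioo 0 A, HasDerivAt W
      (√(1 - (g m + u m) ^ 2) * ((k (g m))⁻¹ + (l (u m))⁻¹) - 4) m := by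
    intro m hm
    have h1 := (gd m hm).2.add (ud m hm).2
    have h2 := (hSd (g m + u m)).comp m h1
    have h3 := h2.sub ((hasDerivAt_id m).const_mul 4)
    rw [mul_one] at h3
    exact h3
  have hkey : ∀ m ∈ Ioo 0 A, 0 < k (g m) ∧ 0 < l (u m) ∧
      k (g m) + l (u m) ≤ √(1 - (g m + u m) ^ 2) := by
    intro m hm
    have h1 := (gd m hm).1
    have h2 := (ud m hm).1
    refine ⟨hkpos _ ⟨h1.1.le, h1.2⟩, hlpos _ ⟨h2.1.le, h2.2⟩, Real.le_sqrt_of_sq_le ?_⟩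
    linarith [h _ ⟨h1.1.le, h1.2.le⟩ _ ⟨h2.1.le, h2.2.le⟩]
  -- The AM-HM defect: it bounds `W'` from below, and its vanishing gives `k = l` along the
  -- transport.
  have hid : ∀ a b : ℝ, 0 < a → 0 < b → (a + b) * (a⁻¹ + b⁻¹) - 4 = (a - b) ^ 2 / (a * b) := by
    intro a b ha hb
    field_simp
    ring
  have hWmono : MonotoneOn W (Icc 0 A) := by
    refine monotoneOn_of_deriv_nonneg (convex_Icc 0 A) hWc.continuousOn ?_ ?_
    · rw [interior_Icc]
      exact fun m hm => (hWd m hm).differentiableAt.differentiableWithinAt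
    · rw [interior_Icc]
      intro m hm
      obtain ⟨ha, hb', hab⟩ := hkey m hm
      rw [(hWd m hm).deriv]
      have h1 := hid _ _ ha hb'
      have h2 : 0 ≤ (k (g m) - l (u m)) ^ 2 / (k (g m) * l (u m)) := by positivity
      have h3 := mul_le_mul_of_nonneg_right hab
        (by positivity : 0 ≤ (k (g m))⁻¹ + (l (u m))⁻¹)
      linarith
  have hW0 : W 0 = 0 := by simp [hW, hS, g0, u0]
  have hWA : W A = Real.pi / 4 - 4 * A := by
    simp only [hW, gA, uA, hbc, hS, integral_sqrt_one_sub_sq_zero_one]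
  have hle := hWmono ⟨le_rfl, hApos.le⟩ ⟨hApos.le, le_rfl⟩ hApos.le
  refine ⟨by linarith, fun hEq => ?_⟩
  have hWz : ∀ m ∈ Icc 0 A, W m = 0 := fun m hm => by
    have h1 := hWmono ⟨le_rfl, hApos.le⟩ hm hm.1
    have h2 := hWmono hm ⟨hApos.le, le_rfl⟩ hm.2
    linarith
  have hab : ∀ m ∈ Ioo 0 A, k (g m) = l (u m) ∧
      (k (g m) + l (u m)) ^ 2 = 1 - (g m + u m) ^ 2 := by
    intro m hm
    obtain ⟨ha, hb', hab⟩ := hkey m hm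
    have hz : HasDerivAt W 0 m := (hasDerivAt_const m (0 : ℝ)).congr_of_eventuallyEq (by
      filter_upwards [Icc_mem_nhds hm.1 hm.2] with y hy using hWz y hy)
    have h0 := (hWd m hm).unique hz
    have h1 := hid _ _ ha hb'
    have h2 : 0 ≤ (k (g m) - l (u m)) ^ 2 / (k (g m) * l (u m)) := by positivity
    have hp : 0 < (k (g m))⁻¹ + (l (u m))⁻¹ := by positivity
    have h3 := mul_le_mul_of_nonneg_right hab hp.le
    have h4 : (k (g m) - l (u m)) ^ 2 / (k (g m) * l (u m)) = 0 := by linarith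
    have h5 : k (g m) - l (u m) = 0 := by
      rcases div_eq_zero_iff.1 h4 with h6 | h6
      · exact pow_eq_zero_iff two_ne_zero |>.1 h6
      · exact absurd h6 (by positivity)
    have h7 : k (g m) + l (u m) = √(1 - (g m + u m) ^ 2) := by
      refine le_antisymm hab (le_of_mul_le_mul_right ?_ hp)
      linarith
    refine ⟨by linarith, ?_⟩
    have h8 : 0 < √(1 - (g m + u m) ^ 2) := by linarith
    rw [h7, Real.sq_sqrt (Real.sqrt_pos.1 h8).le]
  -- Equal heights give `g` and `u` equal derivatives, and both start at 0.
  have hgu : ∀ m ∈ Icc 0 A, g m - u m = 0 := by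
    have hd : ∀ m ∈ Ioo 0 A, HasDerivAt (fun m => g m - u m) 0 m := fun m hm => by
      have h1 := (gd m hm).2.sub (ud m hm).2
      rw [(hab m hm).1, sub_self] at h1
      exact h1
    intro m hm
    rcases hm.1.eq_or_lt with rfl | hm0
    · simp [g0, u0]
    · obtain ⟨z, hz, hz'⟩ := exists_hasDerivAt_eq_slope (fun m => g m - u m) (fun _ => 0) hm0
        (gc.sub uc).continuousOn fun y hy => hd y ⟨hy.1, hy.2.trans_le hm.2⟩
      rw [eq_div_iff (by linarith)] at hz'
      simp only [g0, u0] at hz'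
      linarith
  have hbc' : b = c := by
    have := hgu A ⟨hApos.le, le_rfl⟩
    rw [gA, uA] at this
    linarith
  refine ⟨by linarith, fun x hx => ?_⟩
  obtain ⟨m, hm, rfl⟩ := gs x hx
  have h1 := hgu m ⟨hm.1.le, hm.2.le⟩
  have h2 : u m = g m := by linarith
  obtain ⟨h3, h4⟩ := hab m hm
  rw [h2] at h3 h4
  refine ⟨h3.symm, ?_⟩
  rw [← h3] at h4
  nlinarith

/-! ### Area and rigidity of the sublevel region -/

/-- A quadratic modulus of continuity makes the derivative vanish. -/
theorem eqOn_of_abs_sub_le_sq {D : ℝ → ℝ} {a b : ℝ}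
    (h : ∀ x ∈ Icc a b, ∀ y ∈ Icc a b, |D x - D y| ≤ (x - y) ^ 2) :
    ∀ x ∈ Icc a b, D x = D a := by
  have hd : ∀ x ∈ Icc a b, HasDerivWithinAt D 0 (Icc a b) x := by
    intro x hx
    rw [hasDerivWithinAt_iff_isLittleO]
    have h1 : (fun y => D y - D x - (y - x) • (0 : ℝ)) =O[nhdsWithin x (Icc a b)]
        fun y => (y - x) ^ 2 := by
      refine Asymptotics.IsBigO.of_bound 1 ?_
      filter_upwards [self_mem_nhdsWithin] with y hy
      simpa using h y hy x hx
    refine h1.trans_isLittleO ?_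
    have h2 := (Asymptotics.isLittleO_pow_sub_sub x (m := 2) (by norm_num))
    exact (by simpa using h2 : (fun y : ℝ => (y - x) ^ 2) =o[nhds x] fun y => y - x).mono
      nhdsWithin_le_nhds
  refine constant_of_derivWithin_zero (fun x hx => (hd x hx).differentiableWithinAt)
    fun x hx => ?_
  have hx' : x ∈ Icc a b := ⟨hx.1, hx.2.le⟩
  exact (hd x hx').derivWithin (uniqueDiffOn_Icc (hx.1.trans_lt hx.2) x hx')

theorem volume_subgraph {k : ℝ → ℝ} {b : ℝ} (hb : 0 ≤ b) (hk : Continuous k)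
    (hk0 : ∀ x ∈ Icc 0 b, 0 ≤ k x) :
    volume {p : ℝ × ℝ | p.1 ∈ Icc 0 b ∧ p.2 ∈ Icc 0 (k p.1)} =
      ENNReal.ofReal (∫ t in (0 : ℝ)..b, k t) := by
  have hmeas : MeasurableSet {p : ℝ × ℝ | p.1 ∈ Icc 0 b ∧ p.2 ∈ Icc 0 (k p.1)} := by
    refine IsClosed.measurableSet ?_
    simp only [mem_Icc, ofPred_and]
    refine ((isClosed_le ?_ ?_).inter (isClosed_le ?_ ?_)).inter
      ((isClosed_le ?_ ?_).inter (isClosed_le ?_ ?_)) <;> fun_prop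
  rw [Measure.volume_eq_prod, Measure.prod_apply hmeas]
  have hsec : ∀ x, volume (Prod.mk x ⁻¹' {p : ℝ × ℝ | p.1 ∈ Icc 0 b ∧ p.2 ∈ Icc 0 (k p.1)}) =
      (Icc 0 b).indicator (fun x => ENNReal.ofReal (k x)) x := by
    intro x
    by_cases hx : x ∈ Icc 0 b
    · have : Prod.mk x ⁻¹' {p : ℝ × ℝ | p.1 ∈ Icc 0 b ∧ p.2 ∈ Icc 0 (k p.1)} =
          Icc 0 (k x) := by
        ext y
        exact ⟨fun h => h.2, fun h => ⟨hx, h⟩⟩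
      rw [this, indicator_of_mem hx, Real.volume_Icc, sub_zero]
    · have : Prod.mk x ⁻¹' {p : ℝ × ℝ | p.1 ∈ Icc 0 b ∧ p.2 ∈ Icc 0 (k p.1)} = ∅ := by
        ext y
        exact ⟨fun h => hx h.1, fun h => h.elim⟩
      rw [this, indicator_of_notMem hx, measure_empty]
  simp only [hsec]
  rw [lintegral_indicator measurableSet_Icc, intervalIntegral.integral_of_le hb,
    ← integral_Icc_eq_integral_Ioc, ofReal_integral_eq_lintegral_ofReal]
  · exact hk.continuousOn.integrableOn_Icc
  · exact (ae_restrict_iff' measurableSet_Icc).2 (Filter.Eventually.of_forall hk0)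

theorem volume_sublevel_le_and_eq {F G : ℝ → ℝ} {b c : ℝ} (hb : 0 < b) (hc : 0 < c)
    (hbc : b + c = 1) (hF : Continuous F) (hG : Continuous G)
    (hFm : StrictMonoOn F (Icc 0 b)) (hGm : StrictMonoOn G (Icc 0 c))
    (hF0 : F 0 = 0) (hFb : F b = 1 / 4) (hG0 : G 0 = 0) (hGc : G c = 1 / 4)
    (h : ∀ x ∈ Icc 0 b, ∀ y ∈ Icc 0 c, (x + y) ^ 2 / 2 ≤ F x + G y) :
    volume {p : ℝ × ℝ | p.1 ∈ Icc 0 b ∧ p.2 ∈ Icc 0 c ∧ F p.1 + G p.2 ≤ 1 / 4} ≤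
        ENNReal.ofReal (Real.pi / 16) ∧
      (volume {p : ℝ × ℝ | p.1 ∈ Icc 0 b ∧ p.2 ∈ Icc 0 c ∧ F p.1 + G p.2 ≤ 1 / 4} =
          ENNReal.ofReal (Real.pi / 16) →
        b = 1 / 2 ∧ ∀ x ∈ Icc (0 : ℝ) (1 / 2), F x = x ^ 2 ∧ G x = x ^ 2) := by
  obtain ⟨f', f'c, f'm, f'1, f'2⟩ := exists_continuous_inverse hb.le hF.continuousOn hFm
  obtain ⟨g', g'c, g'm, g'1, g'2⟩ := exists_continuous_inverse hc.le hG.continuousOn hGm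
  rw [hF0, hFb] at f'1
  rw [hG0, hGc] at g'1
  have hFr : ∀ x ∈ Icc 0 b, 1 / 4 - F x ∈ Icc (0 : ℝ) (1 / 4) := fun x hx => by
    have h1 := hFm.monotoneOn ⟨le_rfl, hb.le⟩ hx hx.1
    have h2 := hFm.monotoneOn hx ⟨hb.le, le_rfl⟩ hx.2
    constructor <;> linarith
  have hGr : ∀ y ∈ Icc 0 c, 1 / 4 - G y ∈ Icc (0 : ℝ) (1 / 4) := fun x hx => by
    have h1 := hGm.monotoneOn ⟨le_rfl, hc.le⟩ hx hx.1
    have h2 := hGm.monotoneOn hx ⟨hc.le, le_rfl⟩ hx.2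
    constructor <;> linarith
  -- The curve `F x + G y = 1/4`, solved for `y` and for `x`.
  set k : ℝ → ℝ := fun x => g' (1 / 4 - F x) with hk
  set l : ℝ → ℝ := fun y => f' (1 / 4 - G y) with hl
  have kc : Continuous k := by fun_prop
  have lc : Continuous l := by fun_prop
  have km : ∀ x, k x ∈ Icc 0 c := fun x => g'm _
  have lm : ∀ y, l y ∈ Icc 0 b := fun y => f'm _
  have kG : ∀ x ∈ Icc 0 b, G (k x) = 1 / 4 - F x := fun x hx => g'1 _ (hFr x hx)
  have lF : ∀ y ∈ Icc 0 c, F (l y) = 1 / 4 - G y := fun y hy => f'1 _ (hGr y hy)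
  have hset1 : {p : ℝ × ℝ | p.1 ∈ Icc 0 b ∧ p.2 ∈ Icc 0 c ∧ F p.1 + G p.2 ≤ 1 / 4} =
      {p : ℝ × ℝ | p.1 ∈ Icc 0 b ∧ p.2 ∈ Icc 0 (k p.1)} := by
    ext ⟨x, y⟩
    refine ⟨fun ⟨hx, hy, hxy⟩ => ⟨hx, hy.1, ?_⟩, fun ⟨hx, hy⟩ => ?_⟩
    · refine (hGm.le_iff_le hy (km x)).1 ?_
      rw [kG x hx]
      simp only at hxy
      linarith
    · have hy' : y ∈ Icc 0 c := ⟨hy.1, hy.2.trans (km x).2⟩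
      refine ⟨hx, hy', ?_⟩
      have := (hGm.le_iff_le hy' (km x)).2 hy.2
      rw [kG x hx] at this
      simp only
      linarith
  have hset2 : Prod.swap ⁻¹' {p : ℝ × ℝ | p.1 ∈ Icc 0 b ∧ p.2 ∈ Icc 0 c ∧
      F p.1 + G p.2 ≤ 1 / 4} = {p : ℝ × ℝ | p.1 ∈ Icc 0 c ∧ p.2 ∈ Icc 0 (l p.1)} := by
    ext ⟨y, x⟩
    refine ⟨fun ⟨hx, hy, hxy⟩ => ⟨hy, hx.1, ?_⟩, fun ⟨hy, hx⟩ => ?_⟩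
    · refine (hFm.le_iff_le hx (lm y)).1 ?_
      rw [lF y hy]
      simp only [Prod.swap] at hxy ⊢
      linarith
    · have hx' : x ∈ Icc 0 b := ⟨hx.1, hx.2.trans (lm y).2⟩
      refine ⟨hx', hy, ?_⟩
      have := (hFm.le_iff_le hx' (lm y)).2 hx.2
      rw [lF y hy] at this
      simp only [Prod.swap]
      linarith
  have hv1 := volume_subgraph hb.le kc fun x _ => (km x).1
  have hv2 := volume_subgraph hc.le lc fun y _ => (lm y).1
  have hkI : 0 ≤ ∫ t in (0 : ℝ)..b, k t :=
    intervalIntegral.integral_nonneg hb.le fun x _ => (km x).1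
  have hlI : 0 ≤ ∫ t in (0 : ℝ)..c, l t :=
    intervalIntegral.integral_nonneg hc.le fun x _ => (lm x).1
  -- Both integrals measure the same region, up to swapping coordinates.
  have hint : ∫ t in (0 : ℝ)..b, k t = ∫ t in (0 : ℝ)..c, l t := by
    rw [← ENNReal.ofReal_eq_ofReal_iff hkI hlI, ← hv1, ← hv2, ← hset1, ← hset2]
    exact (MeasurePreserving.measure_preimage_equiv (μa := (volume : Measure (ℝ × ℝ))) (μb := volume)
      (f := MeasurableEquiv.prodComm) Measure.measurePreserving_swap _).symm
  have hkpos : ∀ x ∈ Ico 0 b, 0 < k x := fun x hx => by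
    refine lt_of_le_of_ne (km x).1 fun h0 => ?_
    have h1 := kG x ⟨hx.1, hx.2.le⟩
    rw [← h0, hG0] at h1
    have h2 := hFm ⟨hx.1, hx.2.le⟩ ⟨hb.le, le_rfl⟩ hx.2
    linarith
  have hlpos : ∀ x ∈ Ico 0 c, 0 < l x := fun x hx => by
    refine lt_of_le_of_ne (lm x).1 fun h0 => ?_
    have h1 := lF x ⟨hx.1, hx.2.le⟩
    rw [← h0, hF0] at h1
    have h2 := hGm ⟨hx.1, hx.2.le⟩ ⟨hc.le, le_rfl⟩ hx.2
    linarith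
  obtain ⟨hle, heq⟩ := integral_le_and_eq_of_add_sq_le hb hc hbc kc lc hkpos hlpos hint
    fun x hx y hy => by
      have h1 := h x hx y hy
      have h2 := h _ (lm y) _ (km x)
      rw [lF y hy, kG x hx] at h2
      nlinarith
  rw [hset1, hv1]
  refine ⟨ENNReal.ofReal_le_ofReal hle, fun hE => ?_⟩
  rw [ENNReal.ofReal_eq_ofReal_iff hkI (by positivity)] at hE
  obtain ⟨rfl, hx⟩ := heq hE
  obtain rfl : c = 1 / 2 := by linarith
  refine ⟨rfl, ?_⟩
  -- Now `l = k` and `x² + k(x)² = 1/4`. The diagonal inequality at `x` gives `F + G ≥ 2x²`; at `k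
  -- x` it gives the reverse.
  have hFG : ∀ x ∈ Icc (0 : ℝ) (1 / 2), G x = 2 * x ^ 2 - F x := by
    intro x hx'
    rcases hx'.1.eq_or_lt with rfl | h0
    · rw [hF0, hG0]; norm_num
    rcases hx'.2.eq_or_lt with rfl | h1
    · rw [hFb, hGc]; norm_num
    obtain ⟨h2, h3⟩ := hx x ⟨h0, h1⟩
    have h4 := kG x hx'
    have h5 := lF x hx'
    rw [h2] at h5
    have h6 := h x hx' x hx'
    have h7 := h _ (km x) _ (km x)
    nlinarith
  -- Substituting `G` into the inequality at `(x, y)` and at `(y, x)` bounds the increment of `F x -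
  -- x²` by `(x - y)² / 2`.
  have hD := eqOn_of_abs_sub_le_sq (D := fun x => F x - x ^ 2) (a := 0) (b := 1 / 2)
    fun x hx y hy => by
      have h1 := h x hx y hy
      have h2 := h y hy x hx
      rw [hFG y hy] at h1
      rw [hFG x hx] at h2
      rw [abs_le]
      constructor <;> nlinarith [sq_nonneg (x - y)]
  intro x hx'
  have h1 := hD x hx'
  have h2 := hFG x hx'
  simp only [hF0] at h1
  constructor <;> linarith

theorem volume_quarter_disc :
    volume {p : ℝ × ℝ | p.1 ∈ Icc (0 : ℝ) (1 / 2) ∧ p.2 ∈ Icc (0 : ℝ) (1 / 2) ∧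
      p.1 ^ 2 + p.2 ^ 2 ≤ 1 / 4} = ENNReal.ofReal (Real.pi / 16) := by
  have hset : {p : ℝ × ℝ | p.1 ∈ Icc (0 : ℝ) (1 / 2) ∧ p.2 ∈ Icc (0 : ℝ) (1 / 2) ∧
      p.1 ^ 2 + p.2 ^ 2 ≤ 1 / 4} =
      {p : ℝ × ℝ | p.1 ∈ Icc (0 : ℝ) (1 / 2) ∧
        p.2 ∈ Icc 0 ((fun x : ℝ => 1 / 2 * √(1 - (2 * x) ^ 2)) p.1)} := by
    ext ⟨x, y⟩
    simp only [mem_ofPred_eq, mem_Icc]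
    refine and_congr_right fun hx => ?_
    have h0 : 0 ≤ 1 - (2 * x) ^ 2 := by nlinarith
    constructor
    · rintro ⟨hy, h⟩
      refine ⟨hy.1, ?_⟩
      have := Real.le_sqrt_of_sq_le (x := 2 * y) (y := 1 - (2 * x) ^ 2) (by nlinarith)
      linarith
    · rintro ⟨hy, h⟩
      have h1 := Real.sq_sqrt h0
      have h2 := Real.sqrt_nonneg (1 - (2 * x) ^ 2)
      have h3 : x ^ 2 + y ^ 2 ≤ 1 / 4 := by nlinarith
      exact ⟨⟨hy, by nlinarith [sq_nonneg x]⟩, h3⟩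
  rw [hset, volume_subgraph (k := fun x : ℝ => 1 / 2 * √(1 - (2 * x) ^ 2)) (by norm_num)
    (by fun_prop) fun x _ => by positivity]
  have h1 := intervalIntegral.integral_comp_mul_left (a := 0) (b := 1 / 2)
    (fun t : ℝ => √(1 - t ^ 2)) two_ne_zero
  rw [mul_zero, mul_one_div_cancel two_ne_zero, integral_sqrt_one_sub_sq_zero_one,
    smul_eq_mul] at h1
  rw [intervalIntegral.integral_const_mul, h1]
  congr 1
  ring

/-! ### From the class `F` to the sublevel region -/

/-- The primitive vanishing at `0` of the restriction of `f` to `[0, 1]`. -/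
noncomputable def unitPrimitive (f : ℝ → ℝ) (x : ℝ) : ℝ :=
  ∫ t in (0 : ℝ)..x, (Icc (0 : ℝ) 1).indicator f t

theorem unitPrimitive_zero (f : ℝ → ℝ) : unitPrimitive f 0 = 0 := by
  simp [unitPrimitive]

theorem IsF.integrableOn {f : ℝ → ℝ} (hf : IsF f) : IntegrableOn f (Icc (0 : ℝ) 1) := by
  refine Integrable.of_bound (C := 1) hf.aemeasurable.aestronglyMeasurable ?_
  refine (ae_restrict_iff' measurableSet_Icc).2 (Filter.Eventually.of_forall fun x hx => ?_)
  have := hf.mapsTo hx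
  rw [Real.norm_eq_abs, abs_of_nonneg this.1]
  exact this.2

theorem integrable_unit_indicator {f : ℝ → ℝ} (hf : IntegrableOn f (Icc (0 : ℝ) 1)) :
    Integrable ((Icc (0 : ℝ) 1).indicator f) :=
  (integrable_indicator_iff measurableSet_Icc).2 hf

theorem continuous_unitPrimitive {f : ℝ → ℝ} (hf : IntegrableOn f (Icc (0 : ℝ) 1)) :
    Continuous (unitPrimitive f) :=
  intervalIntegral.continuous_primitive
    (fun _ _ => (integrable_unit_indicator hf).intervalIntegrable) 0

theorem integral_eq_unitPrimitive_sub {f : ℝ → ℝ} (hf : IntegrableOn f (Icc (0 : ℝ) 1))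
    {x y : ℝ} (hx : 0 ≤ x) (hxy : x ≤ y) (hy : y ≤ 1) :
    ∫ t in x..y, f t = unitPrimitive f y - unitPrimitive f x := by
  have hi := fun a b => (integrable_unit_indicator hf).intervalIntegrable (a := a) (b := b)
  rw [unitPrimitive, unitPrimitive,
    intervalIntegral.integral_interval_sub_left (hi _ _) (hi _ _)]
  refine intervalIntegral.integral_congr fun t ht => ?_
  rw [uIcc_of_le hxy] at ht
  exact (indicator_of_mem (s := Icc (0 : ℝ) 1) ⟨hx.trans ht.1, ht.2.trans hy⟩ f).symm

theorem IsF.unitPrimitive_one {f : ℝ → ℝ} (hf : IsF f) : unitPrimitive f 1 = 1 / 2 := by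
  have := integral_eq_unitPrimitive_sub hf.integrableOn le_rfl zero_le_one le_rfl
  rw [hf.integral_eq, unitPrimitive_zero] at this
  linarith

theorem IsF.sq_sub_le {f : ℝ → ℝ} (hf : IsF f) {x y : ℝ} (hx : 0 ≤ x) (hxy : x ≤ y)
    (hy : y ≤ 1) : (y - x) ^ 2 / 2 ≤ unitPrimitive f y - unitPrimitive f x := by
  have h := hf.le_setIntegral (Ioc x y) measurableSet_Ioc
    fun t ht => ⟨hx.trans ht.1.le, ht.2.trans hy⟩
  rw [Real.volume_Ioc, ENNReal.toReal_ofReal (by linarith),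
    ← intervalIntegral.integral_of_le hxy,
    integral_eq_unitPrimitive_sub hf.integrableOn hx hxy hy] at h
  exact h

theorem IsF.strictMonoOn {f : ℝ → ℝ} (hf : IsF f) :
    StrictMonoOn (unitPrimitive f) (Icc 0 1) := fun x hx y hy hxy => by
  have h := hf.sq_sub_le hx.1 hxy.le hy.2
  have : 0 < (y - x) ^ 2 := pow_pos (by linarith) 2
  linarith

theorem IsF.sq_add_le {f : ℝ → ℝ} (hf : IsF f) {x y : ℝ} (hx : 0 ≤ x) (hy : 0 ≤ y)
    (hxy : x + y ≤ 1) :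
    (x + y) ^ 2 / 2 ≤ unitPrimitive f x + (1 / 2 - unitPrimitive f (1 - y)) := by
  have h1 : Ioc 0 x ⊆ Icc (0 : ℝ) 1 := fun t ht => ⟨ht.1.le, by linarith [ht.2]⟩
  have h2 : Ioc (1 - y) 1 ⊆ Icc (0 : ℝ) 1 := fun t ht => ⟨by linarith [ht.1], ht.2⟩
  have hd : Disjoint (Ioc 0 x) (Ioc (1 - y) 1) := by
    rw [disjoint_left]
    intro t ht ht'
    linarith [ht.2, ht'.1]
  have h := hf.le_setIntegral (Ioc 0 x ∪ Ioc (1 - y) 1)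
    (measurableSet_Ioc.union measurableSet_Ioc) (union_subset h1 h2)
  rw [measure_union hd measurableSet_Ioc, Real.volume_Ioc, Real.volume_Ioc,
    ← ENNReal.ofReal_add (by linarith) (by linarith), ENNReal.toReal_ofReal (by linarith),
    setIntegral_union hd measurableSet_Ioc (hf.integrableOn.mono_set h1)
      (hf.integrableOn.mono_set h2),
    ← intervalIntegral.integral_of_le hx, ← intervalIntegral.integral_of_le (by linarith),
    integral_eq_unitPrimitive_sub hf.integrableOn le_rfl hx (by linarith),
    integral_eq_unitPrimitive_sub hf.integrableOn (by linarith) (by linarith) le_rfl,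
    hf.unitPrimitive_one, unitPrimitive_zero] at h
  convert h using 2 <;> ring

theorem IsF.unitPrimitive_eq_quarter {f : ℝ → ℝ} (hf : IsF f) {κ : ℝ} (hκ : κ ∈ Icc (0 : ℝ) 1)
    (h : ∫ x in (0 : ℝ)..κ, f x = 1 / 4) :
    κ ∈ Ioo (0 : ℝ) 1 ∧ unitPrimitive f κ = 1 / 4 := by
  have hq : unitPrimitive f κ = 1 / 4 := by
    rw [integral_eq_unitPrimitive_sub hf.integrableOn le_rfl hκ.1 hκ.2, unitPrimitive_zero] at h
    linarith
  refine ⟨⟨lt_of_le_of_ne hκ.1 ?_, lt_of_le_of_ne hκ.2 ?_⟩, hq⟩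
  · rintro rfl
    rw [unitPrimitive_zero] at hq
    norm_num at hq
  · rintro rfl
    rw [hf.unitPrimitive_one] at hq
    norm_num at hq

/-- The map `(x, y) ↦ (x, 1 - y)` preserves area. An interval `[x, y]` carrying mass 1/4 leaves at
most 1/4 on either side, so it must contain `κ`. -/
theorem IsF.volume_largeSet {f : ℝ → ℝ} (hf : IsF f) {κ : ℝ} (hκ : κ ∈ Ioo (0 : ℝ) 1)
    (hq : unitPrimitive f κ = 1 / 4) :
    volume (largeSet f) = volume {p : ℝ × ℝ | p.1 ∈ Icc 0 κ ∧ p.2 ∈ Icc 0 (1 - κ) ∧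
      unitPrimitive f p.1 + (1 / 2 - unitPrimitive f (1 - p.2)) ≤ 1 / 4} := by
  have hm := hf.strictMonoOn
  have hset : largeSet f = (MeasurableEquiv.prodCongr (MeasurableEquiv.refl ℝ)
      (MeasurableEquiv.subLeft (1 : ℝ))) ⁻¹' {p : ℝ × ℝ | p.1 ∈ Icc 0 κ ∧
        p.2 ∈ Icc 0 (1 - κ) ∧
        unitPrimitive f p.1 + (1 / 2 - unitPrimitive f (1 - p.2)) ≤ 1 / 4} := by
    ext ⟨x, y⟩
    change (x ∈ Icc (0 : ℝ) 1 ∧ y ∈ Icc (0 : ℝ) 1 ∧ x ≤ y ∧ 1 / 4 ≤ ∫ t in x..y, f t) ↔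
      (x ∈ Icc 0 κ ∧ 1 - y ∈ Icc 0 (1 - κ) ∧
        unitPrimitive f x + (1 / 2 - unitPrimitive f (1 - (1 - y))) ≤ 1 / 4)
    rw [sub_sub_cancel]
    have hκ' : κ ∈ Icc (0 : ℝ) 1 := ⟨hκ.1.le, hκ.2.le⟩
    constructor
    · rintro ⟨hx, hy, hxy, h⟩
      rw [integral_eq_unitPrimitive_sub hf.integrableOn hx.1 hxy hy.2] at h
      have h0 := hm.monotoneOn ⟨le_rfl, zero_le_one⟩ hx hx.1
      have h1 := hm.monotoneOn hy ⟨zero_le_one, le_rfl⟩ hy.2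
      rw [unitPrimitive_zero] at h0
      rw [hf.unitPrimitive_one] at h1
      have h2 : x ≤ κ := (hm.le_iff_le hx hκ').1 (by linarith)
      have h3 : κ ≤ y := (hm.le_iff_le hκ' hy).1 (by linarith)
      exact ⟨⟨hx.1, h2⟩, ⟨by linarith [hy.2], by linarith⟩, by linarith⟩
    · rintro ⟨hx, hy, h⟩
      have hκy : κ ≤ y := by linarith [hy.2]
      have hy1 : y ≤ 1 := by linarith [hy.1]
      have hxy : x ≤ y := hx.2.trans hκy
      refine ⟨⟨hx.1, hx.2.trans hκ.2.le⟩, ⟨hκ.1.le.trans hκy, hy1⟩, hxy, ?_⟩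
      rw [integral_eq_unitPrimitive_sub hf.integrableOn hx.1 hxy hy1]
      linarith
  rw [hset]
  exact MeasurePreserving.measure_preimage_equiv
    ((MeasurePreserving.id volume).prod (Measure.measurePreserving_sub_left volume (1 : ℝ))) _

/-! ### The bound and uniqueness for `F_mon` -/

/-- A monotone function with values at most `1` and primitive `x ^ 2` on `[0, 1/2]` is `2 * x`. -/
theorem MonotoneOn.eq_two_mul {g : ℝ → ℝ} (hg : MonotoneOn g (Icc 0 (1 / 2)))
    (h01 : ∀ x ∈ Icc (0 : ℝ) (1 / 2), g x ∈ Icc (0 : ℝ) 1)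
    (hint : ∀ x y : ℝ, 0 ≤ x → x ≤ y → y ≤ 1 / 2 → ∫ t in x..y, g t = y ^ 2 - x ^ 2) :
    ∀ x ∈ Icc (0 : ℝ) (1 / 2), g x = 2 * x := by
  have hi : ∀ x y : ℝ, 0 ≤ x → x ≤ y → y ≤ 1 / 2 → IntervalIntegrable g volume x y :=
    fun x y hx hxy hy => MonotoneOn.intervalIntegrable (by
      rw [uIcc_of_le hxy]
      exact hg.mono (Icc_subset_Icc hx hy))
  intro x hx
  apply le_antisymm
  -- At the endpoint 1/2 the bound is `g ≤ 1`. Elsewhere `g x` is at most the mean `x + y` of `g`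
  -- over `[x, y]`, and `y` is taken close to `x`. The lower bound is symmetric.
  · rcases hx.2.eq_or_lt with rfl | hlt
    · linarith [(h01 _ hx).2]
    refine le_of_forall_pos_le_add fun ε hε => ?_
    set y := min (x + ε) (1 / 2) with hy
    have hxy : x < y := lt_min (by linarith) hlt
    have hy2 : y ≤ 1 / 2 := min_le_right _ _
    have h1 := intervalIntegral.integral_mono_on hxy.le intervalIntegrable_const
      (hi x y hx.1 hxy.le hy2) fun t ht => hg hx ⟨hx.1.trans ht.1, ht.2.trans hy2⟩ ht.1
    rw [hint x y hx.1 hxy.le hy2, intervalIntegral.integral_const, smul_eq_mul] at h1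
    have h2 : g x ≤ x + y := le_of_mul_le_mul_left (by nlinarith) (sub_pos.2 hxy)
    linarith [min_le_left (x + ε) (1 / 2)]
  · rcases hx.1.eq_or_lt with rfl | hlt
    · linarith [(h01 _ hx).1]
    refine le_of_forall_pos_le_add fun ε hε => ?_
    set y := max (x - ε) 0 with hy
    have hxy : y < x := max_lt (by linarith) hlt
    have hy2 : 0 ≤ y := le_max_right _ _
    have h1 := intervalIntegral.integral_mono_on hxy.le (hi y x hy2 hxy.le hx.2)
      intervalIntegrable_const fun t ht => hg ⟨hy2.trans ht.1, ht.2.trans hx.2⟩ hx ht.2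
    rw [hint y x hy2 hxy.le hx.2, intervalIntegral.integral_const, smul_eq_mul] at h1
    have h2 : x + y ≤ g x := le_of_mul_le_mul_left (by nlinarith) (sub_pos.2 hxy)
    linarith [le_max_left (x - ε) 0]

theorem IsFMon.volume_largeSet_le_and_eq {f : ℝ → ℝ} (hf : IsFMon f) :
    volume (largeSet f) ≤ ENNReal.ofReal (Real.pi / 16) ∧
      (volume (largeSet f) = ENNReal.ofReal (Real.pi / 16) →
        EqOn f tentMap (Icc (0 : ℝ) 1)) := by
  obtain ⟨κ, hκ', hκ1, -, hmono, hanti⟩ := hf.exists_mode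
  obtain ⟨hκ, hq⟩ := hf.toIsF.unitPrimitive_eq_quarter hκ' hκ1
  have hc := continuous_unitPrimitive hf.toIsF.integrableOn
  have hm := hf.toIsF.strictMonoOn
  rw [hf.toIsF.volume_largeSet hκ hq]
  obtain ⟨hle, heq⟩ := volume_sublevel_le_and_eq (F := unitPrimitive f)
    (G := fun y => 1 / 2 - unitPrimitive f (1 - y)) hκ.1 (sub_pos.2 hκ.2) (by ring) hc
    (by fun_prop) (hm.mono (Icc_subset_Icc le_rfl hκ.2.le))
    (fun x hx y hy hxy => by
      have := hm (a := 1 - y) (b := 1 - x) ⟨by linarith [hy.2, hκ.1], by linarith [hy.1]⟩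
        ⟨by linarith [hx.2, hκ.1], by linarith [hx.1]⟩ (by linarith)
      simp only
      linarith)
    (unitPrimitive_zero f) hq (by simp [hf.toIsF.unitPrimitive_one])
    (by simp only [sub_sub_cancel, hq]; norm_num)
    (fun x hx y hy => hf.toIsF.sq_add_le hx.1 hy.1 (by linarith [hx.2, hy.2]))
  refine ⟨hle, fun hE => ?_⟩
  obtain ⟨rfl, hFG⟩ := heq hE
  have hI := hf.toIsF.integrableOn
  have hleft := hmono.eq_two_mul
    (fun x hx => hf.mapsTo ⟨hx.1, by linarith [hx.2]⟩)
    fun x y hx hxy hy => by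
      rw [integral_eq_unitPrimitive_sub hI hx hxy (by linarith), (hFG x ⟨hx, by linarith⟩).1,
        (hFG y ⟨by linarith, hy⟩).1]
  have hright := MonotoneOn.eq_two_mul (g := fun x => f (1 - x))
    (fun x hx y hy hxy => hanti ⟨by linarith [hy.2], by linarith [hy.1]⟩
      ⟨by linarith [hx.2], by linarith [hx.1]⟩ (by linarith))
    (fun x hx => hf.mapsTo ⟨by linarith [hx.2], by linarith [hx.1]⟩)
    fun x y hx hxy hy => by
      rw [intervalIntegral.integral_comp_sub_left, integral_eq_unitPrimitive_sub hI (by linarith)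
        (by linarith) (by linarith)]
      linarith [(hFG x ⟨hx, by linarith⟩).2, (hFG y ⟨by linarith, hy⟩).2]
  intro x hx
  rcases le_total x (1 / 2) with h | h
  · rw [hleft x ⟨hx.1, h⟩, tentMap, min_eq_left (by linarith)]
  · have := hright (1 - x) ⟨by linarith [hx.2], by linarith⟩
    simp only [sub_sub_cancel] at this
    rw [this, tentMap, min_eq_right (by linarith)]

/-! ### The tent map -/

theorem continuous_tentMap : Continuous tentMap := by
  unfold tentMap
  fun_prop

theorem tentMap_one_sub (x : ℝ) : tentMap (1 - x) = tentMap x := by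
  rw [tentMap, tentMap, sub_sub_cancel, min_comm]

theorem tentMap_of_le {x : ℝ} (hx : x ≤ 1 / 2) : tentMap x = 2 * x := by
  rw [tentMap, min_eq_left (by linarith)]

theorem integral_tentMap_left {x : ℝ} (hx0 : 0 ≤ x) (hx : x ≤ 1 / 2) :
    ∫ t in (0 : ℝ)..x, tentMap t = x ^ 2 := by
  have : ∫ t in (0 : ℝ)..x, tentMap t = ∫ t in (0 : ℝ)..x, 2 * t := by
    refine intervalIntegral.integral_congr fun t ht => ?_
    rw [uIcc_of_le hx0] at ht
    exact tentMap_of_le (ht.2.trans hx)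
  rw [this, intervalIntegral.integral_const_mul, integral_id]
  ring

theorem integral_tentMap_right {x : ℝ} (hx0 : 0 ≤ x) (hx : x ≤ 1 / 2) :
    ∫ t in (1 - x)..(1 : ℝ), tentMap t = x ^ 2 := by
  rw [← integral_tentMap_left hx0 hx]
  have := intervalIntegral.integral_comp_sub_left (a := 0) (b := x) tentMap 1
  simp only [tentMap_one_sub, sub_zero] at this
  exact this.symm

theorem integral_max_sub_tentMap {s : ℝ} (hs : 0 ≤ s) (hs1 : s ≤ 1) :
    ∫ t in (0 : ℝ)..1, max (s - tentMap t) 0 = s ^ 2 / 2 := by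
  have hc : Continuous fun t => max (s - tentMap t) 0 := by
    have := continuous_tentMap
    fun_prop
  have hi := fun a b => hc.intervalIntegrable (μ := volume) a b
  have h1 : ∫ t in (0 : ℝ)..(s / 2), max (s - tentMap t) 0 = s ^ 2 / 4 := by
    have : ∫ t in (0 : ℝ)..(s / 2), max (s - tentMap t) 0 =
        ∫ t in (0 : ℝ)..(s / 2), (s - tentMap t) := by
      refine intervalIntegral.integral_congr fun t ht => ?_
      rw [uIcc_of_le (by linarith)] at ht
      have h := tentMap_of_le (x := t) (by linarith [ht.2])
      exact max_eq_left (by linarith [ht.2])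
    rw [this, intervalIntegral.integral_sub intervalIntegrable_const
      (continuous_tentMap.intervalIntegrable _ _), integral_tentMap_left (by linarith)
      (by linarith), intervalIntegral.integral_const, smul_eq_mul]
    ring
  have h2 : ∫ t in (s / 2)..(1 / 2), max (s - tentMap t) 0 = 0 := by
    refine intervalIntegral.integral_zero_ae (Filter.Eventually.of_forall fun t ht => ?_)
    rw [uIoc_of_le (by linarith)] at ht
    have h := tentMap_of_le ht.2
    exact max_eq_right (by linarith [ht.1])
  have h3 : ∫ t in (1 / 2)..(1 : ℝ), max (s - tentMap t) 0 =
      ∫ t in (0 : ℝ)..(1 / 2), max (s - tentMap t) 0 := by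
    have := intervalIntegral.integral_comp_sub_left (a := 0) (b := 1 / 2)
      (fun t => max (s - tentMap t) 0) 1
    simp only [tentMap_one_sub, sub_zero] at this
    rw [this]
    norm_num
  have h4 := intervalIntegral.integral_add_adjacent_intervals (hi 0 (s / 2)) (hi _ (1 / 2))
  have h5 := intervalIntegral.integral_add_adjacent_intervals (hi 0 (1 / 2)) (hi _ 1)
  linarith

theorem isFMon_tentMap : IsFMon tentMap where
  aemeasurable := continuous_tentMap.measurable.aemeasurable
  mapsTo x hx := by
    rw [tentMap]
    refine ⟨mul_nonneg zero_le_two (le_min hx.1 (by linarith [hx.2])), ?_⟩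
    linarith [min_le_left x (1 - x), min_le_right x (1 - x)]
  le_setIntegral E hE hE1 := by
    have hfin : volume E ≤ 1 := (measure_mono hE1).trans (by simp)
    set s := (volume E).toReal with hs
    have hs0 : 0 ≤ s := ENNReal.toReal_nonneg
    have hs1 : s ≤ 1 := ENNReal.toReal_le_of_le_ofReal zero_le_one (by simpa using hfin)
    have hI : ∀ g : ℝ → ℝ, Continuous g → IntegrableOn g (Icc (0 : ℝ) 1) :=
      fun g hg => hg.continuousOn.integrableOn_Icc
    have hc := continuous_tentMap
    -- With `s = |E|`, this chain gives `s² - ∫_E f ≤ ∫ (s - f)⁺ = s² / 2` for the tent map `f`.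
    have h1 : ∫ x in E, (s - tentMap x) ≤ ∫ x in E, max (s - tentMap x) 0 :=
      setIntegral_mono ((hI _ (by fun_prop)).mono_set hE1) ((hI _ (by fun_prop)).mono_set hE1)
        fun x => le_max_left _ _
    have h2 : ∫ x in E, max (s - tentMap x) 0 ≤ ∫ x in Icc (0 : ℝ) 1, max (s - tentMap x) 0 :=
      setIntegral_mono_set (hI _ (by fun_prop))
        (Filter.Eventually.of_forall fun x => le_max_right _ _)
        (LE.le.eventuallyLE hE1)
    rw [integral_Icc_eq_integral_Ioc, ← intervalIntegral.integral_of_le zero_le_one,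
      integral_max_sub_tentMap hs0 hs1] at h2
    rw [integral_sub ((hI _ continuous_const).mono_set hE1) ((hI _ hc).mono_set hE1),
      setIntegral_const, smul_eq_mul, measureReal_def, ← hs] at h1
    linarith
  integral_eq := by
    have h1 := integral_tentMap_left (x := 1 / 2) (by norm_num) le_rfl
    have h2 := integral_tentMap_right (x := 1 / 2) (by norm_num) le_rfl
    have h3 := intervalIntegral.integral_add_adjacent_intervals
      (continuous_tentMap.intervalIntegrable (μ := volume) 0 (1 / 2))
      (continuous_tentMap.intervalIntegrable _ 1)
    norm_num at h1 h2 h3 ⊢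
    linarith
  exists_mode := by
    refine ⟨1 / 2, by norm_num, ?_, ?_, ?_, ?_⟩
    · rw [integral_tentMap_left (by norm_num) le_rfl]
      norm_num
    · have := integral_tentMap_right (x := 1 / 2) (by norm_num) le_rfl
      norm_num at this ⊢
      exact this
    · intro x hx y hy hxy
      rw [tentMap_of_le hx.2, tentMap_of_le hy.2]
      linarith
    · intro x hx y hy hxy
      rw [← tentMap_one_sub x, ← tentMap_one_sub y, tentMap_of_le (x := 1 - x) (by linarith [hx.1]),
        tentMap_of_le (x := 1 - y) (by linarith [hy.1])]
      linarith

theorem volume_largeSet_tentMap :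
    volume (largeSet tentMap) = ENNReal.ofReal (Real.pi / 16) := by
  have hF := isFMon_tentMap.toIsF
  have hl : ∀ x ∈ Icc (0 : ℝ) (1 / 2), unitPrimitive tentMap x = x ^ 2 := fun x hx => by
    have := integral_eq_unitPrimitive_sub hF.integrableOn le_rfl hx.1 (by linarith [hx.2])
    rw [integral_tentMap_left hx.1 hx.2, unitPrimitive_zero] at this
    linarith
  have hr : ∀ x ∈ Icc (0 : ℝ) (1 / 2), 1 / 2 - unitPrimitive tentMap (1 - x) = x ^ 2 :=
    fun x hx => by
      have := integral_eq_unitPrimitive_sub hF.integrableOn (x := 1 - x) (y := 1)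
        (by linarith [hx.2]) (by linarith [hx.1]) le_rfl
      rw [integral_tentMap_right hx.1 hx.2, hF.unitPrimitive_one] at this
      linarith
  rw [hF.volume_largeSet (κ := 1 / 2) (by norm_num)
    (by rw [hl _ (by norm_num)]; norm_num), ← volume_quarter_disc]
  congr 1
  ext ⟨x, y⟩
  have hh : (1 : ℝ) - 1 / 2 = 1 / 2 := by norm_num
  simp only [mem_ofPred_eq, hh]
  refine and_congr_right fun hx => and_congr_right fun hy => ?_
  rw [hl x hx, hr y hy]

theorem proposition5p3 :
    (∀ f : ℝ → ℝ, IsFMon f → volume (largeSet f) ≤ ENNReal.ofReal (Real.pi / 16)) ∧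
    (IsFMon tentMap ∧ volume (largeSet tentMap) = ENNReal.ofReal (Real.pi / 16)) ∧
    (∀ f : ℝ → ℝ, IsFMon f → volume (largeSet f) = ENNReal.ofReal (Real.pi / 16) →
      EqOn f tentMap (Icc (0 : ℝ) 1)) :=
  ⟨fun _ hf => hf.volume_largeSet_le_and_eq.1, ⟨isFMon_tentMap, volume_largeSet_tentMap⟩,
    fun _ hf => hf.volume_largeSet_le_and_eq.2⟩
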